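/- Let $X,Y$ be real Banach spaces and let $F(x)=\sum_{m=0}^\infty P_m(x)$ be a power series centred at $0$, where each $P_m:X\to Y$ is a continuous $m$-homogeneous polynomial, i.e. $P_m(x)=L_m(x,\dots,x)$ for some continuous symmetric $m$-linear map $L_m:X^m\to Y$ ($P_0$ is constant). The radius of uniform convergence of a power series $\sum_m Q_m(x-a)$ is the supremum in $[0,\infty]$ of all $r\ge 0$ such that the series converges uniformly on $\{\|x-a\|\le r\}$; equivalently it is $1/\limsup_m\|Q_m\|^{1/m}$ with $\|Q_m\|=\sup_{\|x\|\le1}\|Q_m(x)\|$. Let $\rho$ be the radius of uniform convergence of $\sum_m P_m(x)$ and assume $\rho>0$ ($\rho=\infty$ is allowed), so that $F$ is a function on $D=\{x\in X:\|x\|<\rho\}$. For a function $G$ on $D$ with values in a real Banach space, $G$ is analytic at $a\in D$ if it is infinitely differentiable near $a$, its Taylor series $T_aG(x)=\sum_m\frac1{m!}D^mG(a)\big((x-a)^m\big)$ has a radius of uniform convergence $\rho_a>0$, and $T_aG(x)=G(x)$ for all $x\in D$ with $\|x-a\|<\rho_a$. $G$ is fully analytic in an open set $U\subseteq D$ if it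 is analytic at every $a\in U$ and, for every $a\in U$, $T_aG$ converges uniformly in every closed ball centred at $a$ and contained in $U$. The radius of analyticity $\rho_A(G)\in[0,\infty]$ of $G$ (at $0$) is the supremum of all $r$ such that the open ball $B_r(0)$ is contained in $D$ and $G$ is fully analytic in $B_r(0)$ (with $B_\infty(0)=X$). Then: (i) $\rho_A(F)\ge\rho/\sqrt2$. (ii) $F$ is infinitely differentiable on $D$, and for every $n\ge 0$ the $n$th Fréchet derivative $D^nF:D\to\mathcal L_n(X,Y)$, viewed as a map into the Banach space of continuous $n$-linear maps $X^n\to Y$ (with $D^0F=F$), has a Taylor series at the origin whose radius of uniform convergence is at least $\rho/\sqrt2$ if $n\le 2$ and at least $\rho/\sqrt e$ if $n\ge3$. (iii) For every $n\ge0$, $\rho_A(D^nF)\ge\rho/\sqrt2$. -/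

import Mathlib

open Filter Topology
open scoped ContDiff NNReal

/-- `P : X → Y` is a continuous `m`-homogeneous polynomial: the restriction to the diagonal of a
continuous symmetric `m`-linear map. -/
def IsContHomogPoly {X Y : Type*} [NormedAddCommGroup X] [NormedSpace ℝ X]
    [NormedAddCommGroup Y] [NormedSpace ℝ Y] (m : ℕ) (P : X → Y) : Prop :=
  ∃ L : ContinuousMultilinearMap ℝ (fun _ : Fin m => X) Y,
    (∀ (σ : Equiv.Perm (Fin m)) (v : Fin m → X), L (fun i => v (σ i)) = L v) ∧
      ∀ x, P x = L (fun _ => x)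

/-- The series of functions `∑ₘ P m` converges uniformly on `S`. -/
def SeriesConvergesUniformlyOn {X Y : Type*} [NormedAddCommGroup Y]
    (P : ℕ → X → Y) (S : Set X) : Prop :=
  ∃ G : X → Y, TendstoUniformlyOn (fun N x => ∑ m ∈ Finset.range N, P m x) G atTop S

/-- The radius of uniform convergence of `∑ₘ P m (x - a)`, where the terms `P m` are functions of
the increment `h = x - a`: the supremum of all `r` such that the series converges uniformly on
`‖h‖ ≤ r`. -/
noncomputable def unifConvRadius {X Y : Type*} [NormedAddCommGroup X] [NormedAddCommGroup Y]
    (P : ℕ → X → Y) : ENNReal :=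
  sSup {ρ : ENNReal | ∃ r : ℝ≥0,
    ρ = r ∧ SeriesConvergesUniformlyOn P (Metric.closedBall (0 : X) (r : ℝ))}

/-- The function `x ↦ ∑ₘ P m x` defined by a power series centred at `0`. It is meaningful on the
open ball whose radius is the radius of uniform convergence, see `convDomain`. -/
noncomputable def powerSeriesSum {X Y : Type*} [NormedAddCommGroup Y]
    (P : ℕ → X → Y) (x : X) : Y :=
  ∑' m, P m x

/-- The domain of the function defined by a power series centred at `0`: the open ball about `0`
(all of `X` for an infinite radius) whose radius is the radius of uniform convergence. -/
def convDomain {X Y : Type*} [NormedAddCommGroup X] [NormedAddCommGroup Y]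
    (P : ℕ → X → Y) : Set X :=
  {x : X | edist x 0 < unifConvRadius P}

/-- The terms `h ↦ (1 / m!) DᵐF(a)(h, …, h)` of the Taylor series of `F` at `a`. -/
noncomputable def taylorTerm {X Y : Type*} [NormedAddCommGroup X] [NormedSpace ℝ X]
    [NormedAddCommGroup Y] [NormedSpace ℝ Y] (F : X → Y) (a : X) (m : ℕ) (h : X) : Y :=
  ((m.factorial : ℝ)⁻¹) • iteratedFDeriv ℝ m F a (fun _ => h)

/-- `F` is infinitely differentiable in a neighbourhood of `a`. -/
def SmoothNear {X Y : Type*} [NormedAddCommGroup X] [NormedSpace ℝ X]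
    [NormedAddCommGroup Y] [NormedSpace ℝ Y] (F : X → Y) (a : X) : Prop :=
  ∃ V : Set X, IsOpen V ∧ a ∈ V ∧ ContDiffOn ℝ ∞ F V

/-- A function `F` with domain `D` is analytic at `a`: it is infinitely differentiable near `a`,
its Taylor series at `a` has a positive radius of uniform convergence, and the sum of that series
is `F` at every point of `D` inside the ball of uniform convergence. (Values of `F` outside `D`
have no meaning.) -/
def IsAnalyticAtIn {X Y : Type*} [NormedAddCommGroup X] [NormedSpace ℝ X]
    [NormedAddCommGroup Y] [NormedSpace ℝ Y] (F : X → Y) (D : Set X) (a : X) : Prop :=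
  SmoothNear F a ∧ 0 < unifConvRadius (taylorTerm F a) ∧
    ∀ x ∈ D, edist x a < unifConvRadius (taylorTerm F a) →
      HasSum (fun m => taylorTerm F a m (x - a)) (F x)

/-- A function `F` with domain `D` is fully analytic in `U`: `U` lies in the domain, `F` is analytic
at each `a ∈ U`, and the Taylor series of `F` at `a` converges uniformly in every closed ball
centred at `a` that is contained in `U`. -/
def IsFullyAnalyticIn {X Y : Type*} [NormedAddCommGroup X] [NormedSpace ℝ X]
    [NormedAddCommGroup Y] [NormedSpace ℝ Y] (F : X → Y) (D U : Set X) : Prop :=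
  U ⊆ D ∧ ∀ a ∈ U, IsAnalyticAtIn F D a ∧
    ∀ r : ℝ, 0 < r → Metric.closedBall a r ⊆ U →
      SeriesConvergesUniformlyOn (taylorTerm F a) (Metric.closedBall (0 : X) r)

/-- The radius of analyticity at `a` of a function `F` with domain `D`: the largest (supremum) `r` such that
`F` is fully analytic in the open ball of radius `r` about `a` (all of `X` if `r = ∞`). -/
noncomputable def analyticityRadius {X Y : Type*} [NormedAddCommGroup X] [NormedSpace ℝ X]
    [NormedAddCommGroup Y] [NormedSpace ℝ Y] (F : X → Y) (D : Set X) (a : X) : ENNReal :=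
  sSup {r : ENNReal | IsFullyAnalyticIn F D {x : X | edist x a < r}}

/-!
Let `P m` be the terms of the series, `ρ` its radius of uniform convergence, and `‖a‖ ≤ α`,
`‖h‖ ≤ s` with `√2 (α + s) < ρ`. Along the plane spanned by `a` and `h` the term `P m` is a binary
form, `P m (u a + v h) = ∑ₖ u^{m-k} v^k cₘₖ`, and the `k`-th Taylor term of the sum at `a` is
`∑ₘ cₘₖ`. So everything rests on bounds for the coefficients of binary forms.

A form `p` of degree `m` bounded by `M` on the unit circle is a trigonometric polynomial there, with
Fourier coefficients bounded by `M`. Writing `p` as a combination of the forms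
`(u + iv)^j (u - iv)^{m-j}` extends it to complex arguments with
`|p (u, v)| ≤ (m + 1) M (|u| + |v|)^m`, and Cauchy's estimate bounds its coefficients
(`norm_binaryForm_coeff_le`). For `p (u, v) = P m (u a / α + v h / s)` the points of the unit circle
correspond to vectors of norm at most `√2`, whence `‖cₘₖ‖` is at most a constant times
`(m + 1) (√2 (α + s) / r)^m` for each `r < ρ`. As `s` can be enlarged a little, the double series
`∑ₘ ∑ₖ cₘₖ` converges absolutely and uniformly in `h`, and rearranging it shows that the Taylor
series at `a` converges uniformly on `‖h‖ ≤ s` to the given sum (`exists_taylorTerm_bound`).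

The same coefficient bound on a thin ellipse, with semi-axes `a` and a short multiple of `h`, loses
only a factor `(1 + ε)^m`. It gives two facts on the whole ball of radius `ρ`. The series may be
differentiated term by term without loss of radius, so that every derivative of the sum is again
the sum of a power series of radius at least `ρ`, and the claims for `DⁿF` follow from those for
power series (`exists_iteratedFDeriv_eq_powerSeriesSum`). And the sum is real analytic along each
line, so that the identity principle on the segment from `a` to `x` shows that the Taylor series at
`a` represents the function at all points `x` of the domain within its radius of convergence, also
those beyond `ρ / √2` (`hasSum_taylorTerm`).

Full analyticity of `DⁿF` in the ball of radius `ρ / √2` includes the uniform convergence of its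
Taylor series at the origin on smaller balls, for every `n`; this is stronger than the bound
`ρ / √e` as `2 ≤ e`.
-/

/-! ### Continuous homogeneous polynomials -/

namespace IsContHomogPoly
variable {X Y Z : Type*} [NormedAddCommGroup X] [NormedSpace ℝ X]
  [NormedAddCommGroup Y] [NormedSpace ℝ Y] [NormedAddCommGroup Z] [NormedSpace ℝ Z]

theorem map_smul {m : ℕ} {P : X → Y} (h : IsContHomogPoly m P) (c : ℝ) (x : X) :
    P (c • x) = c ^ m • P x := by
  obtain ⟨L, -, hL⟩ := h
  rw [hL, hL]
  simpa using L.map_smul_univ (fun _ => c) (fun _ => x)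

theorem clm_comp {m : ℕ} {P : X → Y} (h : IsContHomogPoly m P) (A : Y →L[ℝ] Z) :
    IsContHomogPoly m (fun x => A (P x)) := by
  obtain ⟨L, hs, hL⟩ := h
  exact ⟨A.compContinuousMultilinearMap L, fun σ v => by simp [hs σ v], fun x => by simp [hL]⟩

theorem fderiv_zero {P : X → Y} (h : IsContHomogPoly 0 P) (x : X) : fderiv ℝ P x = 0 := by
  obtain ⟨L, -, hL⟩ := h
  have : P = fun _ => L 0 := by
    funext y
    rw [hL]
    congr 1
    exact Subsingleton.elim _ _
  rw [this]
  simp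

theorem differentiable {m : ℕ} {P : X → Y} (h : IsContHomogPoly m P) : Differentiable ℝ P := by
  obtain ⟨L, -, hL⟩ := h
  rw [funext hL]
  intro x
  exact (L.hasFDerivAt _).differentiableAt.comp x (by fun_prop)

/-- The derivative of `x ↦ L (x, …, x)` at `x` is `(m + 1) L (x, …, x, ·)`. -/
theorem fderiv {m : ℕ} {P : X → Y} (h : IsContHomogPoly (m + 1) P) :
    IsContHomogPoly m (fderiv ℝ P) := by
  obtain ⟨L, hs, hL⟩ := h
  refine ⟨((m : ℝ) + 1) • L.curryRight, fun σ v => ?_, fun x => ?_⟩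
  · ext w
    let τ : Equiv.Perm (Fin (m + 1)) :=
      finSuccEquivLast.trans (σ.optionCongr.trans finSuccEquivLast.symm)
    simp only [smul_apply, ContinuousMultilinearMap.curryRight_apply]
    refine congrArg _ (Eq.trans (congrArg L ?_) (hs τ _))
    funext i
    refine Fin.lastCases ?_ (fun j => ?_) i <;> simp [τ]
  · rw [funext hL]
    have h1 : HasFDerivAt (fun x : X => L (fun _ => x))
        ((L.linearDeriv (fun _ => x)).comp (ContinuousLinearMap.pi fun _ => .id ℝ X)) x :=
      (L.hasFDerivAt (fun _ => x)).comp x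
        (ContinuousLinearMap.pi (fun _ : Fin (m+1) => ContinuousLinearMap.id ℝ X)).hasFDerivAt
    rw [h1.fderiv]
    ext w
    simp only [ContinuousLinearMap.comp_apply, ContinuousMultilinearMap.linearDeriv_apply,
      smul_apply, ContinuousMultilinearMap.curryRight_apply, ContinuousLinearMap.pi_apply,
      ContinuousLinearMap.id_apply]
    have h2 : ∀ i : Fin (m + 1), L (Function.update (fun _ => x) i w) =
        L (Fin.snoc (α := fun _ => X) (fun _ => x) w) := by
      intro i
      refine Eq.trans (congrArg L ?_) (hs (Equiv.swap i (Fin.last m)) _)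
      funext j
      by_cases hj : j = i
      · subst hj; simp
      · have h3 : (Equiv.swap i (Fin.last m)) j ≠ Fin.last m := by
          rw [Ne, Equiv.swap_apply_eq_iff, Equiv.swap_apply_right]
          exact hj
        obtain ⟨l, hl⟩ := Fin.exists_castSucc_eq.2 h3
        rw [← hl, Fin.snoc_castSucc, Function.update_of_ne hj]
    simp only [h2, Finset.sum_const, Finset.card_univ, Fintype.card_fin]
    rw [← Nat.cast_smul_eq_nsmul ℝ]
    simp

/-- Along a two-dimensional plane, a homogeneous polynomial is a homogeneous polynomial in two real
variables. -/
theorem exists_coeff {m : ℕ} {P : X → Y} (h : IsContHomogPoly m P) (x y : X) :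
    ∃ c : ℕ → Y, (∀ k, m < k → c k = 0) ∧ ∀ u v : ℝ,
      P (u • x + v • y) = ∑ k ∈ Finset.range (m + 1), (u ^ (m - k) * v ^ k) • c k := by
  classical
  obtain ⟨L, -, hL⟩ := h
  refine ⟨fun k => ∑ s ∈ Finset.powersetCard k (Finset.univ : Finset (Fin m)),
    L (s.piecewise (fun _ => y) (fun _ => x)), fun k hk => ?_, fun u v => ?_⟩
  · have : Finset.powersetCard k (Finset.univ : Finset (Fin m)) = ∅ :=
      Finset.powersetCard_eq_empty.2 (by simpa using hk)
    simp [this]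
  have h1 := L.map_add_univ (fun _ => v • y) (fun _ => u • x)
  rw [hL, show (fun _ : Fin m => u • x + v • y) = (fun _ => v • y) + (fun _ => u • x) by
    funext i; simp [add_comm], h1, ← Finset.powerset_univ,
    Finset.sum_powerset]
  simp only [Finset.card_univ, Fintype.card_fin]
  refine Finset.sum_congr rfl fun k hk => ?_
  rw [Finset.smul_sum]
  refine Finset.sum_congr rfl fun s hs => ?_
  have h2 := L.map_smul_univ (s.piecewise (fun _ => v) (fun _ => u))
    (s.piecewise (fun _ => y) (fun _ => x))
  have h3 : (fun i => s.piecewise (fun _ => v) (fun _ => u) i •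
      s.piecewise (fun _ => y) (fun _ => x) i) =
      s.piecewise (fun _ => v • y) (fun _ => u • x) := by
    funext i
    by_cases hi : i ∈ s <;> simp [hi]
  rw [h3] at h2
  rw [h2]
  congr 1
  rw [Finset.prod_piecewise]
  simp [Finset.mem_powersetCard.1 hs, Finset.card_sdiff, mul_comm]

end IsContHomogPoly

/-! ### Coefficients of binary forms -/

/-- Cauchy's estimate for the coefficients of a polynomial, from Parseval's identity. -/
theorem Polynomial.norm_coeff_mul_pow_le (p : Polynomial ℂ) {R M : ℝ} (hR : 0 ≤ R)
    (h : ∀ z : ℂ, ‖z‖ = R → ‖p.eval z‖ ≤ M) (k : ℕ) : ‖p.coeff k‖ * R ^ k ≤ M := by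
  have hM : 0 ≤ M := (norm_nonneg _).trans (h R (by simp [abs_of_nonneg hR]))
  let q := p.comp (Polynomial.C (R : ℂ) * Polynomial.X)
  have hq : ‖q.coeff k‖ = ‖p.coeff k‖ * R ^ k := by
    simp [q, Polynomial.comp_C_mul_X_coeff, abs_of_nonneg hR]
  rw [← hq]
  have h1 : ∑ i ∈ q.support, ‖q.coeff i‖ ^ 2 ≤ M ^ 2 := by
    rw [Polynomial.sum_sq_norm_coeff_eq_circleAverage]
    refine Real.circleAverage_mono_on_of_le_circle ?_ ?_
    · apply ContinuousOn.circleIntegrable'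
      exact (((Polynomial.continuous _).norm).pow 2).continuousOn
    · intro z hz
      have hz' : ‖z‖ = 1 := by simpa using hz
      have : ‖q.eval z‖ ≤ M := by
        simp only [q, Polynomial.eval_comp]
        exact h _ (by simp [hz', abs_of_nonneg hR])
      gcongr
  by_cases hk : k ∈ q.support
  · have h2 := (Finset.single_le_sum (f := fun i => ‖q.coeff i‖ ^ 2)
      (fun i _ => by positivity) hk).trans h1
    exact le_of_sq_le_sq h2 hM
  · rw [Polynomial.notMem_support_iff.1 hk]
    simpa using hM

open Complex in
/-- If a real binary form `∑ₖ cₖ u^{d-k} v^k` is bounded by `M` on the unit circle, then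
`∑ₖ cₖ t^k` is bounded by `(d + 1) M (1 + |t|)^d` for complex `t`.

On the circle the form `p` is a trigonometric polynomial `∑ⱼ bⱼ e^{i(2j-d)θ}`, whose Fourier
coefficients satisfy `|bⱼ| ≤ M`; as a form it is `∑ⱼ bⱼ (u + iv)^j (u - iv)^{d-j}`, which also makes
sense at complex arguments. -/
theorem norm_binaryForm_le {d : ℕ} {c : ℕ → ℝ} {M : ℝ}
    (h : ∀ θ : ℝ, |∑ k ∈ Finset.range (d + 1),
      Real.cos θ ^ (d - k) * Real.sin θ ^ k * c k| ≤ M) (t : ℂ) :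
    ‖∑ k ∈ Finset.range (d + 1), (c k : ℂ) * t ^ k‖ ≤ (d + 1) * M * (1 + ‖t‖) ^ d := by
  have hM : 0 ≤ M := (abs_nonneg _).trans (h 0)
  -- `g (e^{2iθ}) = e^{idθ} p (cos θ, sin θ)`
  let g : Polynomial ℂ := ∑ k ∈ Finset.range (d + 1), Polynomial.C (c k : ℂ) *
    ((Polynomial.C (1 / 2) * (Polynomial.X + 1)) ^ (d - k) *
      (Polynomial.C (1 / (2 * I)) * (Polynomial.X - 1)) ^ k)
  -- Its coefficients are the `bⱼ`.
  have hgdeg : g.natDegree ≤ d := by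
    refine Polynomial.natDegree_sum_le_of_forall_le _ _ fun k hk => ?_
    have hk' : k ≤ d := Nat.lt_succ_iff.1 (Finset.mem_range.1 hk)
    have h1 : (Polynomial.C (1 / 2 : ℂ) * (Polynomial.X + 1)).natDegree ≤ 1 := by compute_degree
    have h2 : (Polynomial.C (1 / (2 * I) : ℂ) * (Polynomial.X - 1)).natDegree ≤ 1 := by
      compute_degree
    refine (Polynomial.natDegree_C_mul_le _ _).trans (Polynomial.natDegree_mul_le.trans ?_)
    have := Polynomial.natDegree_pow_le_of_le (d - k) h1
    have := Polynomial.natDegree_pow_le_of_le k h2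
    omega
  have hgcirc : ∀ w : ℂ, ‖w‖ = 1 → ‖g.eval w‖ ≤ M := by
    intro w hw
    obtain ⟨φ, rfl⟩ : ∃ φ : ℝ, cexp (φ * I) = w := (Complex.norm_eq_one_iff w).1 hw
    have key : g.eval (cexp (φ * I)) = cexp ((φ / 2 : ℝ) * I) ^ d *
        ((∑ k ∈ Finset.range (d + 1),
          Real.cos (φ / 2) ^ (d - k) * Real.sin (φ / 2) ^ k * c k : ℝ) : ℂ) := by
      have hz : cexp (φ * I) = cexp ((φ / 2 : ℝ) * I) ^ 2 := by
        rw [← Complex.exp_nat_mul]; congr 1; push_cast; ring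
      have hzn : cexp ((φ / 2 : ℝ) * I) * cexp (-((φ / 2 : ℝ) * I)) = 1 := by
        rw [← Complex.exp_add]; simp
      have hcos : (1 / 2 : ℂ) * (cexp (φ * I) + 1) =
          cexp ((φ / 2 : ℝ) * I) * Complex.cos (φ / 2 : ℝ) := by
        rw [Complex.cos, hz, neg_mul]; linear_combination (-1 / 2 : ℂ) * hzn
      have hsin : (1 / (2 * I) : ℂ) * (cexp (φ * I) - 1) =
          cexp ((φ / 2 : ℝ) * I) * Complex.sin (φ / 2 : ℝ) := by
        rw [Complex.sin, hz, neg_mul]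
        have : (1 / (2 * I) : ℂ) = - I / 2 := by field_simp; simp
        rw [this]; linear_combination (-I / 2 : ℂ) * hzn
      simp only [g, Polynomial.eval_finsetSum, Polynomial.eval_mul, Polynomial.eval_C,
        Polynomial.eval_pow, Polynomial.eval_add, Polynomial.eval_sub, Polynomial.eval_X,
        Polynomial.eval_one, hcos, hsin]
      push_cast
      rw [Finset.mul_sum]
      refine Finset.sum_congr rfl fun k hk => ?_
      have hk' : k ≤ d := Nat.lt_succ_iff.1 (Finset.mem_range.1 hk)
      conv_rhs => rw [← Nat.sub_add_cancel hk', pow_add]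
      simp only [Nat.sub_add_cancel hk']
      ring
    rw [key, norm_mul, norm_pow, Complex.norm_exp_ofReal_mul_I, one_pow, one_mul,
      Complex.norm_real]
    exact h _
  have hcoef : ∀ j, ‖g.coeff j‖ ≤ M := fun j => by
    simpa using g.norm_coeff_mul_pow_le zero_le_one hgcirc j
  -- Dehomogenization: `w = (1 + it) / (1 - it)`.
  have hid : (fun t : ℂ => ∑ k ∈ Finset.range (d + 1), (c k : ℂ) * t ^ k) = fun t : ℂ =>
      ∑ j ∈ Finset.range (d + 1), g.coeff j * ((1 + I * t) ^ j * (1 - I * t) ^ (d - j)) := by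
    refine Continuous.ext_on (dense_compl_singleton (-I)) (by fun_prop) (by fun_prop) ?_
    intro t ht
    have hne : 1 - I * t ≠ 0 := by
      intro h0
      apply ht
      have : I * (1 - I * t) = 0 := by rw [h0, mul_zero]
      have h3 : I + t = 0 := by linear_combination this + t * Complex.I_sq
      exact eq_neg_of_add_eq_zero_right h3
    have e1 : g.eval ((1 + I * t) / (1 - I * t)) * (1 - I * t) ^ d =
        ∑ k ∈ Finset.range (d + 1), (c k : ℂ) * t ^ k := by
      have hU : (1 / 2 : ℂ) * ((1 + I * t) / (1 - I * t) + 1) = 1 / (1 - I * t) := by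
        field_simp; ring
      have hV : (1 / (2 * I) : ℂ) * ((1 + I * t) / (1 - I * t) - 1) = t / (1 - I * t) := by
        field_simp; ring
      simp only [g, Polynomial.eval_finsetSum, Polynomial.eval_mul, Polynomial.eval_C,
        Polynomial.eval_pow, Polynomial.eval_add, Polynomial.eval_sub, Polynomial.eval_X,
        Polynomial.eval_one, hU, hV]
      rw [Finset.sum_mul]
      refine Finset.sum_congr rfl fun k hk => ?_
      have hk' : k ≤ d := Nat.lt_succ_iff.1 (Finset.mem_range.1 hk)
      have e : (1 - I * t) ^ d = (1 - I * t) ^ (d - k) * (1 - I * t) ^ k := by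
        rw [← pow_add, Nat.sub_add_cancel hk']
      rw [e, div_pow, div_pow]
      field_simp
      simp
    have e2 : g.eval ((1 + I * t) / (1 - I * t)) * (1 - I * t) ^ d =
        ∑ j ∈ Finset.range (d + 1), g.coeff j * ((1 + I * t) ^ j * (1 - I * t) ^ (d - j)) := by
      rw [Polynomial.eval_eq_sum_range' (Nat.lt_succ_iff.2 hgdeg), Finset.sum_mul]
      refine Finset.sum_congr rfl fun k hk => ?_
      have hk' : k ≤ d := Nat.lt_succ_iff.1 (Finset.mem_range.1 hk)
      have e : (1 - I * t) ^ d = (1 - I * t) ^ (d - k) * (1 - I * t) ^ k := by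
        rw [← pow_add, Nat.sub_add_cancel hk']
      rw [e, div_pow]
      field_simp
    exact e1.symm.trans e2
  rw [congrFun hid t]
  have hterm : ∀ j ∈ Finset.range (d + 1),
      ‖g.coeff j * ((1 + I * t) ^ j * (1 - I * t) ^ (d - j))‖ ≤ M * (1 + ‖t‖) ^ d := by
    intro j hj
    have hj' : j ≤ d := Nat.lt_succ_iff.1 (Finset.mem_range.1 hj)
    have b1 : ‖1 + I * t‖ ≤ 1 + ‖t‖ := by simpa using norm_add_le (1 : ℂ) (I * t)
    have b2 : ‖1 - I * t‖ ≤ 1 + ‖t‖ := by simpa using norm_sub_le (1 : ℂ) (I * t)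
    rw [norm_mul, norm_mul, norm_pow, norm_pow]
    calc _ ≤ M * ((1 + ‖t‖) ^ j * (1 + ‖t‖) ^ (d - j)) := by gcongr; exact hcoef j
      _ = _ := by rw [← pow_add, Nat.add_sub_cancel' hj']
  calc _ ≤ ∑ j ∈ Finset.range (d + 1), M * (1 + ‖t‖) ^ d := norm_sum_le_of_le _ hterm
    _ = _ := by simp; ring

/-- Coefficients of a vector-valued binary form of degree `d` that is bounded by `M` on the unit
circle. A norming functional reduces the claim to real coefficients, and there it is Cauchy's
estimate on the circle `|t| = τ` for the extension to complex `t`. -/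
theorem norm_binaryForm_coeff_le {Y : Type*} [NormedAddCommGroup Y] [NormedSpace ℝ Y]
    {d : ℕ} {c : ℕ → Y} {M : ℝ}
    (h : ∀ θ : ℝ, ‖∑ k ∈ Finset.range (d + 1),
      (Real.cos θ ^ (d - k) * Real.sin θ ^ k) • c k‖ ≤ M) {τ : ℝ} (hτ : 0 ≤ τ)
    {k : ℕ} (hk : k ≤ d) :
    ‖c k‖ * τ ^ k ≤ (d + 1) * M * (1 + τ) ^ d := by
  obtain ⟨φ, hφ1, hφ2⟩ := exists_dual_vector'' ℝ (c k)
  let p : Polynomial ℂ := ∑ j ∈ Finset.range (d + 1), Polynomial.monomial j (φ (c j) : ℂ)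
  have hp : p.coeff k = (φ (c k) : ℂ) := by
    simp [p, Polynomial.coeff_monomial, Nat.lt_succ_iff.2 hk]
  have := p.norm_coeff_mul_pow_le hτ (M := (d + 1) * M * (1 + τ) ^ d) (fun z hz => ?_) k
  · rw [hp, hφ2] at this
    simpa using this
  · simp only [p, Polynomial.eval_finsetSum, Polynomial.eval_monomial]
    rw [← hz]
    refine norm_binaryForm_le (fun θ => ?_) z
    have e : ∑ k ∈ Finset.range (d + 1), Real.cos θ ^ (d - k) * Real.sin θ ^ k * φ (c k) =
        φ (∑ k ∈ Finset.range (d + 1), (Real.cos θ ^ (d - k) * Real.sin θ ^ k) • c k) := by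
      simp [map_sum]
    rw [e, ← Real.norm_eq_abs]
    exact (φ.le_of_opNorm_le hφ1 _).trans (by simpa using h θ)

/-! ### Radius of uniform convergence and geometric bounds -/

theorem seriesConvergesUniformlyOn_of_norm_le {X Y : Type*} [NormedAddCommGroup Y]
    [CompleteSpace Y] {P : ℕ → X → Y} {S : Set X}
    {u : ℕ → ℝ} (hu : Summable u) (h : ∀ m, ∀ x ∈ S, ‖P m x‖ ≤ u m) :
    SeriesConvergesUniformlyOn P S :=
  ⟨_, tendstoUniformlyOn_tsum_nat hu h⟩

theorem le_unifConvRadius {X Y : Type*} [NormedAddCommGroup X] [NormedAddCommGroup Y]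
    {P : ℕ → X → Y} {r : ℝ≥0}
    (h : SeriesConvergesUniformlyOn P (Metric.closedBall 0 (r : ℝ))) :
    (r : ENNReal) ≤ unifConvRadius P :=
  le_sSup ⟨r, rfl, h⟩

theorem exists_norm_lt_ofReal_lt {X : Type*} [NormedAddCommGroup X] {x : X} {R : ENNReal}
    (h : edist x 0 < R) :
    ∃ r : ℝ, 0 < r ∧ ‖x‖ < r ∧ ENNReal.ofReal r < R := by
  obtain ⟨r, h1, h2⟩ := ENNReal.lt_iff_exists_nnreal_btwn.1 h
  have hx : ‖x‖ < r := by
    rw [edist_zero_right, ← ofReal_norm, ENNReal.ofReal_lt_coe_iff (norm_nonneg _)] at h1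
    exact h1
  exact ⟨r, (norm_nonneg x).trans_lt hx, hx, by simp [h2]⟩

theorem edist_zero_lt_of_norm_lt {X : Type*} [NormedAddCommGroup X] {x : X} {r : ℝ}
    (h : ‖x‖ < r) {R : ENNReal} (hr : ENNReal.ofReal r ≤ R) :
    edist x 0 < R := by
  refine lt_of_lt_of_le ?_ hr
  rw [edist_zero_right, ← ofReal_norm]
  exact ENNReal.ofReal_lt_ofReal_iff_of_nonneg (norm_nonneg _) |>.2 h

section Radius
variable {X Y : Type*} [NormedAddCommGroup X] [NormedSpace ℝ X]
  [NormedAddCommGroup Y] [NormedSpace ℝ Y]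

/-- The terms of a uniformly convergent series are uniformly bounded on the ball; homogeneity turns
this into a geometric bound at all points. -/
theorem exists_norm_le_of_lt_unifConvRadius {P : ℕ → X → Y} (hP : ∀ m, IsContHomogPoly m (P m))
    {r : ℝ} (hr : 0 < r) (h : ENNReal.ofReal r < unifConvRadius P) :
    ∃ C : ℝ, 0 ≤ C ∧ ∀ m x, ‖P m x‖ ≤ C * (‖x‖ / r) ^ m := by
  obtain ⟨_, ⟨r', rfl, G, hG⟩, hr'⟩ := lt_sSup_iff.1 h
  have hrr' : r ≤ r' := by
    have := (ENNReal.ofReal_lt_coe_iff hr.le).1 hr'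
    exact this.le
  obtain ⟨N, hN⟩ := eventually_atTop.1 (Metric.tendstoUniformlyOn_iff.1 hG 1 one_pos)
  choose L hs hL using hP
  have hb : ∀ m x, ‖x‖ = r → ‖P m x‖ ≤ 2 + ∑ j ∈ Finset.range N, ‖L j‖ * r ^ j := by
    intro m x hx
    have hnn : ∀ j, 0 ≤ ‖L j‖ * r ^ j := fun j => by positivity
    rcases lt_or_ge m N with hm | hm
    · have h1 : ‖P m x‖ ≤ ‖L m‖ * r ^ m := by
        rw [hL]
        simpa [hx] using (L m).le_opNorm (fun _ => x)
      have h2 := Finset.single_le_sum (f := fun j => ‖L j‖ * r ^ j) (fun j _ => hnn j)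
        (Finset.mem_range.2 hm)
      linarith
    · have hxm : x ∈ Metric.closedBall (0 : X) (r' : ℝ) := by simpa [hx] using hrr'
      have h1 := hN m hm x hxm
      have h2 := hN (m + 1) (hm.trans (Nat.le_succ m)) x hxm
      rw [Finset.sum_range_succ, dist_eq_norm] at h2
      rw [dist_eq_norm] at h1
      have h3 : P m x = (G x - ∑ j ∈ Finset.range m, P j x) -
          (G x - (∑ j ∈ Finset.range m, P j x + P m x)) := by abel
      have h4 := norm_sub_le (G x - ∑ j ∈ Finset.range m, P j x)
          (G x - (∑ j ∈ Finset.range m, P j x + P m x))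
      rw [← h3] at h4
      have := Finset.sum_nonneg (s := Finset.range N) (fun j _ => hnn j)
      linarith
  have hC : 0 ≤ 2 + ∑ j ∈ Finset.range N, ‖L j‖ * r ^ j := by positivity
  have hhom : ∀ m, IsContHomogPoly m (P m) := fun m => ⟨L m, hs m, hL m⟩
  refine ⟨(2 + ∑ j ∈ Finset.range N, ‖L j‖ * r ^ j) + ‖L 0‖, by positivity, fun m x => ?_⟩
  by_cases hx : x = 0
  · subst hx
    rcases Nat.eq_zero_or_pos m with rfl | hm
    · have : ‖P 0 0‖ ≤ ‖L 0‖ := by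
        rw [hL]; simp
      simp only [pow_zero, mul_one]
      linarith
    · have : P m 0 = 0 := by
        have := (hhom m).map_smul 0 (0 : X)
        simpa [hm.ne'] using this
      simp [this, hm.ne']
  · have hx' : 0 < ‖x‖ := norm_pos_iff.2 hx
    have e : x = (‖x‖ / r) • ((r / ‖x‖) • x) := by
      rw [smul_smul, div_mul_div_cancel₀ hr.ne', div_self hx'.ne', one_smul]
    have e2 : ‖(r / ‖x‖) • x‖ = r := by
      rw [norm_smul, Real.norm_of_nonneg (by positivity), div_mul_cancel₀ _ hx'.ne']
    calc ‖P m x‖ = (‖x‖ / r) ^ m * ‖P m ((r / ‖x‖) • x)‖ := by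
          conv_lhs => rw [e, (hhom m).map_smul, norm_smul,
            Real.norm_of_nonneg (by positivity)]
      _ ≤ (‖x‖ / r) ^ m * (2 + ∑ j ∈ Finset.range N, ‖L j‖ * r ^ j + ‖L 0‖) := by
          gcongr
          have := hb m _ e2
          have := norm_nonneg (L 0)
          linarith
      _ = _ := mul_comm _ _

/-- A geometric bound on `P` gives a bound on the coefficients of `P (u x + v y)`, in which the
norms of `x` and `y` enter only through the largest norm `B` on the ellipse `cos θ x + sin θ y`. -/
theorem norm_coeff_mul_pow_le {m : ℕ} {P : X → Y} {C r : ℝ} (hC : 0 ≤ C) (hr : 0 < r)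
    (hP : ∀ x, ‖P x‖ ≤ C * (‖x‖ / r) ^ m) {x y : X} {c : ℕ → Y} (hc0 : ∀ k, m < k → c k = 0)
    (hc : ∀ u v : ℝ,
      P (u • x + v • y) = ∑ k ∈ Finset.range (m + 1), (u ^ (m - k) * v ^ k) • c k)
    {B : ℝ} (hB : ∀ θ : ℝ, ‖Real.cos θ • x + Real.sin θ • y‖ ≤ B) {τ : ℝ} (hτ : 0 ≤ τ) (k : ℕ) :
    ‖c k‖ * τ ^ k ≤ (m + 1) * C * (B / r * (1 + τ)) ^ m := by
  have hB0 : 0 ≤ B := (norm_nonneg _).trans (hB 0)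
  rcases lt_or_ge m k with hk | hk
  · rw [hc0 k hk]
    simp only [norm_zero, zero_mul]
    positivity
  · have := norm_binaryForm_coeff_le (c := c) (d := m) (M := C * (B / r) ^ m) (fun θ => ?_) hτ hk
    · rw [mul_pow]
      linarith
    · rw [← hc]
      refine (hP _).trans ?_
      gcongr
      exact hB θ

end Radius

/-! ### Rearrangement of double series -/

theorem norm_tsum_coeff_le {Y : Type*} [NormedAddCommGroup Y] {c : ℕ → ℕ → Y} {q : ℝ}
    {w : ℕ → ℝ} (hw : Summable w)
    (hc : ∀ m k, ‖c m k‖ ≤ q ^ k * w m) (k : ℕ) : ‖∑' m, c m k‖ ≤ q ^ k * ∑' m, w m := by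
  rw [← tsum_mul_left]
  exact tsum_of_norm_bounded (hw.mul_left (q ^ k)).hasSum fun m => hc m k

section Rearrangement
variable {Y : Type*} [NormedAddCommGroup Y] [NormedSpace ℝ Y] [CompleteSpace Y]

/-- Collecting powers of `t` in `∑ₘ ∑ₖ≤ₘ tᵏ c m k`. -/
theorem hasSum_rearranged {c : ℕ → ℕ → Y} (hc0 : ∀ m k, m < k → c m k = 0) {q : ℝ} (hq : 0 ≤ q)
    {w : ℕ → ℝ} (hw : Summable w) (hw0 : ∀ m, 0 ≤ w m) (hc : ∀ m k, ‖c m k‖ ≤ q ^ k * w m)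
    {t : ℝ} (ht : |t| * q < 1) :
    HasSum (fun k => t ^ k • ∑' m, c m k)
      (∑' m, ∑ k ∈ Finset.range (m + 1), t ^ k • c m k) := by
  let f : ℕ × ℕ → Y := fun p => t ^ p.2 • c p.1 p.2
  have hf : Summable f := by
    have hg := hw.mul_of_nonneg (summable_geometric_of_lt_one (by positivity) ht)
      (fun m => hw0 m) (fun k => by positivity)
    refine Summable.of_norm_bounded hg fun p => ?_
    simp only [f, norm_smul, norm_pow, Real.norm_eq_abs]
    calc |t| ^ p.2 * ‖c p.1 p.2‖ ≤ |t| ^ p.2 * (q ^ p.2 * w p.1) := by gcongr; exact hc _ _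
      _ = _ := by rw [mul_pow]; ring
  have h1 : HasSum (fun m => ∑ k ∈ Finset.range (m + 1), t ^ k • c m k) (∑' p, f p) := by
    refine hf.hasSum.prod_fiberwise fun m => ?_
    refine hasSum_sum_of_ne_finset_zero fun k hk => ?_
    simp only [f]
    rw [hc0 m k (by simpa [Nat.lt_succ_iff] using hk), smul_zero]
  rw [h1.tsum_eq, ← (Equiv.prodComm ℕ ℕ).tsum_eq]
  refine ((Equiv.prodComm ℕ ℕ).summable_iff.2 hf).hasSum.prod_fiberwise fun k => ?_
  have : Summable fun m => c m k := Summable.of_norm_bounded (hw.mul_left (q ^ k)) fun m => hc m k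
  exact this.hasSum.const_smul _

end Rearrangement

/-! ### Restriction to lines -/

section Line
variable {X Y : Type*} [NormedAddCommGroup X] [NormedSpace ℝ X]
  [NormedAddCommGroup Y] [NormedSpace ℝ Y]

theorem iteratedDeriv_comp_line {F : X → Y} {V : Set X} (hV : IsOpen V) (hF : ContDiffOn ℝ ∞ F V)
    (a h : X) (k : ℕ) : ∀ t : ℝ, a + t • h ∈ V →
      iteratedDeriv k (fun s : ℝ => F (a + s • h)) t =
        iteratedFDeriv ℝ k F (a + t • h) (fun _ => h) := by
  induction k with
  | zero => intro t _; simp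
  | succ k ih =>
    intro t ht
    have hopen : ∀ᶠ s : ℝ in 𝓝 t, a + s • h ∈ V :=
      (show Continuous fun s : ℝ => a + s • h by fun_prop).continuousAt.eventually
        (hV.mem_nhds ht)
    rw [iteratedDeriv_succ, Filter.EventuallyEq.deriv_eq (hopen.mono ih),
      iteratedFDeriv_succ_apply_left]
    have hd : DifferentiableAt ℝ (iteratedFDeriv ℝ k F) (a + t • h) :=
      ((hF.contDiffAt (hV.mem_nhds ht)).differentiableAt_iteratedFDeriv
        (by exact_mod_cast WithTop.coe_lt_top k))
    have hl : HasDerivAt (fun s : ℝ => a + s • h) h t := by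
      simpa using ((hasDerivAt_id t).smul_const h).const_add a
    have h1 := hd.hasFDerivAt.comp_hasDerivAt t hl
    have h2 := (ContinuousMultilinearMap.apply ℝ (fun _ : Fin k => X) Y
      (fun _ => h)).hasFDerivAt.comp_hasDerivAt t h1
    exact h2.deriv

/-- The one-variable power series with coefficients `d`. -/
noncomputable def scalarSeries (d : ℕ → Y) : FormalMultilinearSeries ℝ ℝ Y :=
  fun n => ContinuousMultilinearMap.mkPiRing ℝ (Fin n) (d n)

theorem coeff_scalarSeries (d : ℕ → Y) (n : ℕ) : (scalarSeries d).coeff n = d n := by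
  simp [scalarSeries, FormalMultilinearSeries.coeff]

theorem hasFPowerSeriesAt_scalarSeries {φ : ℝ → Y} {d : ℕ → Y}
    (h : ∀ᶠ t : ℝ in 𝓝 0, HasSum (fun k => t ^ k • d k) (φ t)) :
    HasFPowerSeriesAt φ (scalarSeries d) 0 := by
  rw [hasFPowerSeriesAt_iff]
  simpa [coeff_scalarSeries] using h

/-- The Taylor terms of a smooth function can be read off from any expansion in powers of `t` along
the line `a + t h`. -/
theorem taylorTerm_eq_of_hasSum_line [CompleteSpace Y] {F : X → Y} {a h : X}
    (hF : SmoothNear F a) {d : ℕ → Y}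
    (hd : ∀ᶠ t : ℝ in 𝓝 0, HasSum (fun k => t ^ k • d k) (F (a + t • h))) (k : ℕ) :
    taylorTerm F a k h = d k := by
  obtain ⟨V, hV, haV, hFV⟩ := hF
  obtain ⟨r, hr⟩ := hasFPowerSeriesAt_scalarSeries (φ := fun t => F (a + t • h)) hd
  have h1 := hr.factorial_smul 1 k
  rw [← iteratedDeriv_eq_iteratedFDeriv, iteratedDeriv_comp_line hV hFV a h k 0 (by simpa)] at h1
  have h2 : (scalarSeries d) k (fun _ => 1) = d k := coeff_scalarSeries d k
  rw [h2] at h1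
  rw [taylorTerm]
  simp only [zero_smul, add_zero] at h1
  rw [← h1, ← Nat.cast_smul_eq_nsmul ℝ, smul_smul, inv_mul_cancel₀ (by positivity), one_smul]

end Line

/-! ### Differentiation inside the ball of convergence -/

theorem le_unifConvRadius_of_forall_lt {X Y : Type*} [NormedAddCommGroup X]
    [NormedAddCommGroup Y] {P : ℕ → X → Y} {R : ENNReal}
    (h : ∀ r : ℝ≥0, (r : ENNReal) < R →
      SeriesConvergesUniformlyOn P (Metric.closedBall 0 (r : ℝ))) : R ≤ unifConvRadius P := by
  refine le_of_forall_lt fun s hs => ?_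
  obtain ⟨r, h1, h2⟩ := ENNReal.lt_iff_exists_nnreal_btwn.1 hs
  exact h1.trans_le (le_unifConvRadius (h r h2))

theorem isOpen_convDomain {X Y : Type*} [NormedAddCommGroup X] [NormedAddCommGroup Y]
    (P : ℕ → X → Y) : IsOpen (convDomain P) :=
  isOpen_lt (by fun_prop) continuous_const

section PowerSeries
variable {X Y : Type*} [NormedAddCommGroup X] [NormedSpace ℝ X]
  [NormedAddCommGroup Y] [NormedSpace ℝ Y]

theorem summable_succ_mul_geometric (C : ℝ) {Q : ℝ} (hQ0 : 0 ≤ Q) (hQ : Q < 1) :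
    Summable fun m : ℕ => ((m : ℝ) + 1) * C * Q ^ m := by
  have h1 := summable_pow_mul_geometric_of_norm_lt_one 1 (r := Q)
    (by rwa [Real.norm_of_nonneg hQ0])
  have h2 := summable_geometric_of_lt_one hQ0 hQ
  refine ((h1.add h2).mul_left C).congr fun m => ?_
  simp only [pow_one]
  ring

theorem norm_cos_smul_add_sin_smul_le (x y : X) (θ : ℝ) :
    ‖Real.cos θ • x + Real.sin θ • y‖ ≤ ‖x‖ + ‖y‖ := by
  refine (norm_add_le _ _).trans ?_
  rw [norm_smul, norm_smul]
  exact add_le_add (mul_le_of_le_one_left (norm_nonneg _) (Real.abs_cos_le_one θ))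
    (mul_le_of_le_one_left (norm_nonneg _) (Real.abs_sin_le_one θ))

/-- The source of the factor `√2`: an ellipse spanned by two vectors of the unit ball of an
arbitrary norm lies in the ball of radius `√2`. -/
theorem norm_cos_smul_add_sin_smul_le_sqrt_two {x y : X} (hx : ‖x‖ ≤ 1) (hy : ‖y‖ ≤ 1) (θ : ℝ) :
    ‖Real.cos θ • x + Real.sin θ • y‖ ≤ √2 := by
  refine (norm_add_le _ _).trans ?_
  rw [norm_smul, norm_smul, Real.norm_eq_abs, Real.norm_eq_abs]
  have h1 : |Real.cos θ| * ‖x‖ + |Real.sin θ| * ‖y‖ ≤ |Real.cos θ| + |Real.sin θ| :=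
    add_le_add (mul_le_of_le_one_right (abs_nonneg _) hx)
      (mul_le_of_le_one_right (abs_nonneg _) hy)
  refine h1.trans (Real.le_sqrt_of_sq_le ?_)
  nlinarith [sq_abs (Real.cos θ), sq_abs (Real.sin θ), Real.sin_sq_add_cos_sq θ,
    sq_nonneg (|Real.cos θ| - |Real.sin θ|)]

/-- Room for an increment of norm `δ` (the factor `(b + δ) / r`) and for complex parameters of
modulus `δ` in Cauchy's estimate (the factor `1 + δ`). -/
theorem exists_margin_mul_lt_one {b r : ℝ} (hb : 0 ≤ b) (h : b < r) :
    ∃ δ > 0, 0 ≤ (b + δ) / r * (1 + δ) ∧ (b + δ) / r * (1 + δ) < 1 := by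
  have hr : 0 < r := hb.trans_lt h
  have hlim : Tendsto (fun δ : ℝ => (b + δ) / r * (1 + δ)) (𝓝[>] 0) (𝓝 ((b + 0) / r * (1 + 0))) :=
    tendsto_nhdsWithin_of_tendsto_nhds
      ((by fun_prop : Continuous fun δ : ℝ => (b + δ) / r * (1 + δ)).tendsto 0)
  have hlt : (b + 0) / r * (1 + 0) < 1 := by
    rw [add_zero, add_zero, mul_one, div_lt_one hr]; exact h
  obtain ⟨δ, h1, h2⟩ := ((hlim.eventually_lt_const hlt).and self_mem_nhdsWithin).exists
  have h2' : 0 < δ := h2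
  exact ⟨δ, h2', by positivity, h1⟩

/-- At every point of the ball of convergence, the sum is real analytic along lines. Only a short
increment is used, so that the ellipse spanned by it and `a` stays within the ball. -/
theorem exists_hasSum_line [CompleteSpace Y] {P : ℕ → X → Y} (hP : ∀ m, IsContHomogPoly m (P m))
    {a : X} (ha : a ∈ convDomain P) (h : X) :
    ∃ d : ℕ → Y, ∀ᶠ t : ℝ in 𝓝 0, HasSum (fun k => t ^ k • d k) (powerSeriesSum P (a + t • h)) := by
  obtain ⟨r, hr, har, hrρ⟩ := exists_norm_lt_ofReal_lt ha
  obtain ⟨C, hC, hb⟩ := exists_norm_le_of_lt_unifConvRadius hP hr hrρ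
  obtain ⟨δ, hδ, hQ0, hQ⟩ := exists_margin_mul_lt_one (norm_nonneg a) har
  -- The increment is rescaled to have norm at most `δ`.
  obtain ⟨ε, hε, hεh⟩ : ∃ ε > (0 : ℝ), ‖ε • h‖ ≤ δ := by
    refine ⟨δ / (‖h‖ + 1), by positivity, ?_⟩
    rw [norm_smul, Real.norm_of_nonneg (by positivity), div_mul_eq_mul_div,
      div_le_iff₀ (by positivity)]
    nlinarith [norm_nonneg h]
  choose c hc0 hc using fun m => (hP m).exists_coeff a (ε • h)
  have hcb : ∀ m k, ‖c m k‖ ≤ (1 / δ) ^ k * ((m + 1) * C * ((‖a‖ + δ) / r * (1 + δ)) ^ m) := by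
    intro m k
    have := norm_coeff_mul_pow_le hC hr (hb m) (hc0 m) (hc m) (B := ‖a‖ + δ)
      (fun θ => (norm_cos_smul_add_sin_smul_le _ _ θ).trans (by gcongr)) hδ.le k
    rw [one_div, inv_pow, ← div_eq_inv_mul, le_div_iff₀ (by positivity)]
    exact this
  have hw := summable_succ_mul_geometric C hQ0 hQ
  refine ⟨fun k => (1 / ε) ^ k • ∑' m, c m k, ?_⟩
  have hev : ∀ᶠ t : ℝ in 𝓝 0, |t / ε| * (1 / δ) < 1 := by
    have : Tendsto (fun t : ℝ => |t / ε| * (1 / δ)) (𝓝 0) (𝓝 (|0 / ε| * (1 / δ))) :=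
      (by fun_prop : Continuous fun t : ℝ => |t / ε| * (1 / δ)).tendsto 0
    exact this.eventually_lt_const (by simp)
  filter_upwards [hev] with t ht
  have h1 := hasSum_rearranged hc0 (q := 1 / δ) (by positivity) hw
    (fun m => by positivity) hcb ht
  convert h1 using 1
  · funext k
    rw [smul_smul, ← mul_pow]
    simp [div_eq_mul_inv]
  · refine tsum_congr fun m => ?_
    have h2 := hc m 1 (t / ε)
    rw [one_smul, smul_smul, div_mul_cancel₀ _ hε.ne'] at h2
    simpa using h2

/-- The derivatives of the terms are summable, uniformly on smaller balls. The derivative of `P m`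
at `x` in the direction `v` is the coefficient of `t` in `P m (x + t v)`. -/
theorem exists_summable_norm_fderiv_le {P : ℕ → X → Y}
    (hP : ∀ m, IsContHomogPoly m (P m)) {r' r : ℝ} (hr' : 0 ≤ r') (hr : r' < r)
    (hrρ : ENNReal.ofReal r < unifConvRadius P) :
    ∃ w : ℕ → ℝ, Summable w ∧ ∀ m, ∀ x : X, ‖x‖ ≤ r' → ‖fderiv ℝ (P m) x‖ ≤ w m := by
  have hr0 : 0 < r := hr'.trans_lt hr
  obtain ⟨C, hC, hb⟩ := exists_norm_le_of_lt_unifConvRadius hP hr0 hrρ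
  obtain ⟨δ, hδ, hQ0, hQ⟩ := exists_margin_mul_lt_one hr' hr
  refine ⟨fun m => ((m + 1) * C * ((r' + δ) / r * (1 + δ)) ^ m) * (1 / (δ * δ)),
    (summable_succ_mul_geometric C hQ0 hQ).mul_right _, fun m x hx => ?_⟩
  refine ContinuousLinearMap.opNorm_le_of_unit_norm (by positivity) fun v hv => ?_
  obtain ⟨c, hc0, hc⟩ := (hP m).exists_coeff x (δ • v)
  have h1 := norm_coeff_mul_pow_le hC hr0 (hb m) hc0 hc (B := r' + δ)
    (fun θ => (norm_cos_smul_add_sin_smul_le _ _ θ).trans (by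
      rw [norm_smul, hv, Real.norm_of_nonneg hδ.le, mul_one]; gcongr)) hδ.le 1
  have hd : c 1 = δ • fderiv ℝ (P m) x v := by
    have hl : HasDerivAt (fun s : ℝ => (1 : ℝ) • x + s • (δ • v)) (δ • v) 0 := by
      simpa using ((hasDerivAt_id (0 : ℝ)).smul_const (δ • v)).const_add ((1 : ℝ) • x)
    have e1 := ((hP m).differentiable ((1 : ℝ) • x + (0 : ℝ) • (δ • v))).hasFDerivAt.comp_hasDerivAt
      (0 : ℝ) hl
    have e2 : HasDerivAt (fun s : ℝ => ∑ k ∈ Finset.range (m + 1), s ^ k • c k)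
        (∑ k ∈ Finset.range (m + 1), ((k : ℝ) * 0 ^ (k - 1)) • c k) 0 :=
      HasDerivAt.fun_sum fun k _ => (hasDerivAt_pow k (0 : ℝ)).smul_const (c k)
    have e3 : (P m ∘ fun s : ℝ => (1 : ℝ) • x + s • (δ • v)) =
        fun s : ℝ => ∑ k ∈ Finset.range (m + 1), s ^ k • c k := by
      funext s; simpa using hc 1 s
    rw [e3] at e1
    have e4 := e1.unique e2
    simp only [one_smul, zero_smul, add_zero, _root_.map_smul] at e4
    rw [e4]
    symm
    by_cases hm : 1 ≤ m
    · rw [Finset.sum_eq_single 1]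
      · simp
      · intro k _ hk
        rcases Nat.eq_zero_or_pos k with rfl | hk0
        · simp
        · rw [zero_pow (by omega)]; simp
      · intro h; exact absurd (Finset.mem_range.2 (by omega)) h
    · rw [hc0 1 (by omega)]
      have : m = 0 := by omega
      subst this
      simp
  rw [hd, norm_smul, Real.norm_of_nonneg hδ.le, pow_one] at h1
  simp only [mul_one_div]
  rw [le_div_iff₀ (by positivity)]
  linarith

theorem summable_norm_of_mem_convDomain {P : ℕ → X → Y}
    (hP : ∀ m, IsContHomogPoly m (P m)) {x : X} (hx : x ∈ convDomain P) :
    Summable fun m => ‖P m x‖ := by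
  obtain ⟨r, hr, hxr, hrρ⟩ := exists_norm_lt_ofReal_lt hx
  obtain ⟨C, hC, hb⟩ := exists_norm_le_of_lt_unifConvRadius hP hr hrρ
  refine Summable.of_nonneg_of_le (fun _ => norm_nonneg _) (fun m => hb m x) ?_
  exact (summable_geometric_of_lt_one (by positivity) ((div_lt_one hr).2 hxr)).mul_left C

theorem unifConvRadius_le_fderiv [CompleteSpace Y] {P : ℕ → X → Y}
    (hP : ∀ m, IsContHomogPoly m (P m)) :
    unifConvRadius P ≤ unifConvRadius fun m => fderiv ℝ (P (m + 1)) := by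
  refine le_unifConvRadius_of_forall_lt fun r' hr' => ?_
  obtain ⟨r, h1, h2⟩ := ENNReal.lt_iff_exists_nnreal_btwn.1 hr'
  obtain ⟨w, hw, hb⟩ := exists_summable_norm_fderiv_le hP r'.2
    (r := r) (by exact_mod_cast h1) (by simpa using h2)
  exact seriesConvergesUniformlyOn_of_norm_le ((summable_nat_add_iff 1).2 hw)
    fun m x hx => hb (m + 1) x (by simpa using hx)

theorem hasFDerivAt_powerSeriesSum [CompleteSpace Y] {P : ℕ → X → Y}
    (hP : ∀ m, IsContHomogPoly m (P m)) {x : X} (hx : x ∈ convDomain P) :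
    HasFDerivAt (powerSeriesSum P) (powerSeriesSum (fun m => fderiv ℝ (P (m + 1))) x) x := by
  obtain ⟨r, hr, hxr, hrρ⟩ := exists_norm_lt_ofReal_lt hx
  obtain ⟨r', hr1, hr2⟩ := exists_between hxr
  have hr'0 : 0 < r' := (norm_nonneg x).trans_lt hr1
  obtain ⟨w, hw, hb⟩ := exists_summable_norm_fderiv_le hP hr'0.le hr2 hrρ
  have h1 := hasFDerivAt_tsum_of_isPreconnected hw (Metric.isOpen_ball (x := (0 : X)) (ε := r'))
    (convex_ball _ _).isPreconnected
    (fun m y _ => ((hP m).differentiable y).hasFDerivAt)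
    (fun m y hy => hb m y (by simpa using (mem_ball_zero_iff.1 hy).le))
    (mem_ball_zero_iff.2 hr1) (summable_norm_of_mem_convDomain hP hx).of_norm
    (mem_ball_zero_iff.2 hr1)
  have h2 : Summable fun m => fderiv ℝ (P m) x := .of_norm_bounded hw fun m => hb m x hr1.le
  rw [h2.tsum_eq_zero_add, (hP 0).fderiv_zero, zero_add] at h1
  exact h1

theorem unifConvRadius_le_comp_isometry {X Z W : Type*} [NormedAddCommGroup X]
    [NormedAddCommGroup Z] [NormedSpace ℝ Z]
    [NormedAddCommGroup W] [NormedSpace ℝ W] (I : Z ≃ₗᵢ[ℝ] W) (Q : ℕ → X → Z) :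
    unifConvRadius Q ≤ unifConvRadius fun m x => I (Q m x) := by
  refine sSup_le_sSup ?_
  rintro _ ⟨r, rfl, G, hG⟩
  refine ⟨r, rfl, fun x => I (G x), ?_⟩
  rw [Metric.tendstoUniformlyOn_iff] at hG ⊢
  intro ε hε
  filter_upwards [hG ε hε] with N hN x hx
  rw [← map_sum, I.dist_map]
  exact hN x hx

theorem IsContHomogPoly.comp_isometry {Z W : Type*} [NormedAddCommGroup Z] [NormedSpace ℝ Z]
    [NormedAddCommGroup W] [NormedSpace ℝ W] (I : Z ≃ₗᵢ[ℝ] W) {m : ℕ} {Q : X → Z}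
    (hQ : IsContHomogPoly m Q) : IsContHomogPoly m fun x => I (Q x) :=
  hQ.clm_comp I.toContinuousLinearEquiv.toContinuousLinearMap

theorem powerSeriesSum_comp_isometry {Z W : Type*} [NormedAddCommGroup Z] [NormedSpace ℝ Z]
    [CompleteSpace Z] [NormedAddCommGroup W] [NormedSpace ℝ W] (I : Z ≃ₗᵢ[ℝ] W) {Q : ℕ → X → Z}
    (hQ : ∀ m, IsContHomogPoly m (Q m)) {x : X} (hx : x ∈ convDomain Q) :
    powerSeriesSum (fun m x => I (Q m x)) x = I (powerSeriesSum Q x) :=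
  ((summable_norm_of_mem_convDomain hQ hx).of_norm.hasSum.map I I.continuous).tsum_eq

/-- Term-by-term differentiation; the isometry `I` serves to identify linear maps into multilinear
maps with multilinear maps in one more variable. -/
theorem exists_fderiv_eq_powerSeriesSum {Z W : Type*} [NormedAddCommGroup Z] [NormedSpace ℝ Z]
    [CompleteSpace Z] [NormedAddCommGroup W] [NormedSpace ℝ W] (I : (X →L[ℝ] Z) ≃ₗᵢ[ℝ] W)
    {Q : ℕ → X → Z} (hQ : ∀ m, IsContHomogPoly m (Q m)) {D : Set X} (hDo : IsOpen D)
    (hD : D ⊆ convDomain Q) {F : X → Z} (hF : ∀ x ∈ D, F x = powerSeriesSum Q x) :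
    ∃ Q' : ℕ → X → W, (∀ m, IsContHomogPoly m (Q' m)) ∧ unifConvRadius Q ≤ unifConvRadius Q' ∧
      ∀ x ∈ D, I (fderiv ℝ F x) = powerSeriesSum Q' x := by
  have hQ' : ∀ m, IsContHomogPoly m (fderiv ℝ (Q (m + 1))) := fun m => (hQ (m + 1)).fderiv
  have hρ := unifConvRadius_le_fderiv hQ
  refine ⟨fun m x => I (fderiv ℝ (Q (m + 1)) x), fun m => (hQ' m).comp_isometry I,
    hρ.trans (unifConvRadius_le_comp_isometry I _), fun x hx => ?_⟩
  have e : F =ᶠ[𝓝 x] powerSeriesSum Q := by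
    filter_upwards [hDo.mem_nhds hx] with y hy using hF y hy
  rw [powerSeriesSum_comp_isometry I hQ' (lt_of_lt_of_le (hD hx) hρ), e.fderiv_eq,
    (hasFDerivAt_powerSeriesSum hQ (hD hx)).fderiv]

/-- Inside the ball of convergence, the `n`-th derivative of the sum
of a power series is again the sum of a power series, with at least the same radius. -/
theorem exists_iteratedFDeriv_eq_powerSeriesSum [CompleteSpace Y] {P : ℕ → X → Y}
    (hP : ∀ m, IsContHomogPoly m (P m)) (n : ℕ) :
    ∃ Q : ℕ → X → ContinuousMultilinearMap ℝ (fun _ : Fin n => X) Y,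
      (∀ m, IsContHomogPoly m (Q m)) ∧ unifConvRadius P ≤ unifConvRadius Q ∧
      ∀ x ∈ convDomain P, iteratedFDeriv ℝ n (powerSeriesSum P) x = powerSeriesSum Q x := by
  induction n with
  | zero =>
    let I := (continuousMultilinearCurryFin0 ℝ X Y).symm
    refine ⟨fun m x => I (P m x),
      fun m => (hP m).comp_isometry I,
      unifConvRadius_le_comp_isometry I P, fun x hx => ?_⟩
    rw [powerSeriesSum_comp_isometry I hP hx, iteratedFDeriv_zero_eq_comp]
    rfl
  | succ n ih =>
    obtain ⟨Q, hQ, hρ, hF⟩ := ih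
    obtain ⟨Q', hQ', hρ', hF'⟩ := exists_fderiv_eq_powerSeriesSum
      (continuousMultilinearCurryLeftEquiv ℝ (fun _ : Fin (n + 1) => X) Y).symm hQ
      (isOpen_convDomain P) (fun x hx => lt_of_lt_of_le hx hρ) hF
    exact ⟨Q', hQ', hρ.trans hρ', fun x hx =>
      (congrFun iteratedFDeriv_succ_eq_comp_left x).trans (hF' x hx)⟩

theorem contDiffOn_powerSeriesSum [CompleteSpace Y] {P : ℕ → X → Y}
    (hP : ∀ m, IsContHomogPoly m (P m)) : ContDiffOn ℝ ∞ (powerSeriesSum P) (convDomain P) := by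
  refine contDiffOn_of_differentiableOn fun n _ => ?_
  obtain ⟨Q, hQ, hρ, hF⟩ := exists_iteratedFDeriv_eq_powerSeriesSum hP n
  refine DifferentiableOn.congr (f := powerSeriesSum Q) (fun x hx => ?_) fun x hx => ?_
  · exact (hasFDerivAt_powerSeriesSum hQ
      (lt_of_lt_of_le hx hρ)).differentiableAt.differentiableWithinAt
  · rw [iteratedFDerivWithin_of_isOpen n (isOpen_convDomain P) hx, hF x hx]

end PowerSeries

/-! ### Taylor series at points of the ball of radius `ρ / √2` -/

section TaylorTerms
variable {X Y : Type*} [NormedAddCommGroup X] [NormedSpace ℝ X]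
  [NormedAddCommGroup Y] [NormedSpace ℝ Y]

/-- Symmetry of the multilinear map is no restriction: averaging over all permutations of the
variables does not change the diagonal. -/
theorem isContHomogPoly_of_diagonal {m : ℕ}
    (L : ContinuousMultilinearMap ℝ (fun _ : Fin m => X) Y) :
    IsContHomogPoly m fun x => L fun _ => x := by
  refine ⟨((m.factorial : ℝ)⁻¹) • ∑ σ : Equiv.Perm (Fin m), L.domDomCongr σ,
    fun τ v => ?_, fun x => ?_⟩
  · simp only [smul_apply, sum_apply,
      ContinuousMultilinearMap.domDomCongr_apply]
    congr 1
    exact Fintype.sum_equiv (Equiv.mulLeft τ) _ _ fun σ => rfl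
  · simp only [smul_apply, sum_apply,
      ContinuousMultilinearMap.domDomCongr_apply, Finset.sum_const, Finset.card_univ,
      Fintype.card_perm, Fintype.card_fin]
    rw [← Nat.cast_smul_eq_nsmul ℝ, smul_smul, inv_mul_cancel₀ (by positivity), one_smul]

theorem isContHomogPoly_taylorTerm (F : X → Y) (a : X) (m : ℕ) :
    IsContHomogPoly m (taylorTerm F a m) :=
  isContHomogPoly_of_diagonal (((m.factorial : ℝ)⁻¹) • iteratedFDeriv ℝ m F a)

theorem taylorTerm_congr {F G : X → Y} {a : X} (h : F =ᶠ[𝓝 a] G) : 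
    taylorTerm F a = taylorTerm G a := by
  funext m x
  rw [taylorTerm, taylorTerm, (Filter.EventuallyEq.iteratedFDeriv ℝ h m).eq_of_nhds]

theorem IsFullyAnalyticIn.le_unifConvRadius_taylorTerm {G : X → Y} {D : Set X} {R : ENNReal}
    (h : IsFullyAnalyticIn G D {x | edist x 0 < R}) (hR : 0 < R) :
    R ≤ unifConvRadius (taylorTerm G 0) := by
  refine le_of_forall_lt fun s hs => ?_
  obtain ⟨r, h1, h2⟩ := ENNReal.lt_iff_exists_nnreal_btwn.1 hs
  refine h1.trans_le (le_unifConvRadius ((h.2 0 (by simpa using hR)).2 r ?_ fun x hx => ?_))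
  · exact_mod_cast zero_le.trans_lt h1
  · refine lt_of_le_of_lt ?_ h2
    rw [Metric.mem_closedBall, dist_zero_right] at hx
    rw [edist_zero_right]
    exact_mod_cast hx

end TaylorTerms

/-- A closed ball about `a` contained in an open ball of radius `R` about `0` has radius `s` with
`‖a‖ + s < R`. In the zero space the radius of a ball is not determined by the ball, so `s` need not
be the given `r`. -/
theorem exists_norm_add_lt_of_closedBall_subset {X : Type*} [NormedAddCommGroup X]
    [NormedSpace ℝ X] {a : X} {r : ℝ} (hr : 0 < r) {R : ENNReal}
    (ha : edist a 0 < R) (h : Metric.closedBall a r ⊆ {x : X | edist x 0 < R}) :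
    ∃ s > 0, ENNReal.ofReal (‖a‖ + s) < R ∧
      Metric.closedBall (0 : X) r ⊆ Metric.closedBall 0 s := by
  rcases subsingleton_or_nontrivial X with hX | hX
  · obtain ⟨s, hs, h1, h2⟩ := exists_norm_lt_ofReal_lt ha
    refine ⟨s, hs, ?_, fun x _ => ?_⟩
    · rwa [Subsingleton.elim a 0, norm_zero, zero_add]
    · rw [Subsingleton.elim x 0]; simpa using hs.le
  · refine ⟨r, hr, ?_, le_rfl⟩
    obtain ⟨v, hv, hav⟩ : ∃ v : X, ‖v‖ = r ∧ ‖a + v‖ = ‖a‖ + r := by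
      by_cases ha0 : a = 0
      · obtain ⟨v, hv⟩ := exists_norm_eq X hr.le
        exact ⟨v, hv, by simp [ha0, hv]⟩
      · have ha' : 0 < ‖a‖ := norm_pos_iff.2 ha0
        have hv : ‖(r / ‖a‖) • a‖ = r := by
          rw [norm_smul, Real.norm_of_nonneg (by positivity), div_mul_cancel₀ _ ha'.ne']
        refine ⟨(r / ‖a‖) • a, hv, ?_⟩
        rw [(SameRay.sameRay_nonneg_smul_right a (by positivity)).norm_add, hv]
    have h1 := h (show a + v ∈ Metric.closedBall a r by simp [hv])
    simp only [Set.mem_ofPred_eq, edist_zero_right] at h1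
    rwa [← ofReal_norm, hav] at h1

section FullyAnalytic
variable {X Y : Type*} [NormedAddCommGroup X] [NormedSpace ℝ X]
  [NormedAddCommGroup Y] [NormedSpace ℝ Y] [CompleteSpace Y]

theorem smoothNear_powerSeriesSum {P : ℕ → X → Y} (hP : ∀ m, IsContHomogPoly m (P m))
    {a : X} (ha : a ∈ convDomain P) : SmoothNear (powerSeriesSum P) a :=
  ⟨_, isOpen_convDomain P, ha, contDiffOn_powerSeriesSum hP⟩

/-- The quantitative core: if `‖a‖ ≤ α` and `√2 (α + s) < ρ`, then the Taylor series at `a`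
converges to the function on `‖h‖ ≤ s`, with geometrically decreasing terms. Its `k`-th term is the sum
over `m` of the coefficient of `u^{m-k} v^k` in `P m (u a + v h)`, bounded through the ellipse spanned
by `a / α` and `h / s`. -/
theorem exists_taylorTerm_bound {P : ℕ → X → Y} (hP : ∀ m, IsContHomogPoly m (P m))
    {a : X} {α s r : ℝ} (hα : 0 < α) (ha : ‖a‖ ≤ α) (hs : 0 < s) (hr : √2 * (α + s) < r)
    (hrρ : ENNReal.ofReal r < unifConvRadius P) :
    ∃ q W : ℝ, 0 ≤ q ∧ q < 1 ∧ ∀ h : X, ‖h‖ ≤ s →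
      (∀ k, ‖taylorTerm (powerSeriesSum P) a k h‖ ≤ q ^ k * W) ∧
      HasSum (fun k => taylorTerm (powerSeriesSum P) a k h) (powerSeriesSum P (a + h)) := by
  have h2 : (1 : ℝ) ≤ √2 := Real.one_le_sqrt.2 (by norm_num)
  have hαs : α + s < r := lt_of_le_of_lt (le_mul_of_one_le_left (by positivity) h2) hr
  have hr0 : 0 < r := lt_trans (by positivity) hαs
  have haD : a ∈ convDomain P :=
    edist_zero_lt_of_norm_lt (lt_of_le_of_lt ha (by linarith)) hrρ.le
  obtain ⟨C, hC, hb⟩ := exists_norm_le_of_lt_unifConvRadius hP hr0 hrρ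
  -- A slightly larger radius `s'` gains the geometric factor `(s / s')^k`.
  obtain ⟨s', hss', hs'r⟩ : ∃ s' > s, √2 * (α + s') < r := by
    have : s < r / √2 - α := by
      rw [lt_sub_iff_add_lt, add_comm, lt_div_iff₀ (by positivity)]
      linarith
    obtain ⟨s', h1, h3⟩ := exists_between this
    refine ⟨s', h1, ?_⟩
    rw [lt_sub_iff_add_lt, add_comm, lt_div_iff₀ (by positivity)] at h3
    linarith
  have hs'0 : 0 < s' := hs.trans hss'
  set Q := √2 * (α + s') / r with hQdef
  have hQ0 : 0 ≤ Q := by positivity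
  have hQ1 : Q < 1 := (div_lt_one hr0).2 hs'r
  have hw := summable_succ_mul_geometric C hQ0 hQ1
  have hq1 : s / s' < 1 := (div_lt_one hs'0).2 hss'
  refine ⟨s / s', ∑' m : ℕ, ((m : ℝ) + 1) * C * Q ^ m, by positivity, hq1, fun h hh => ?_⟩
  have hx : ‖α⁻¹ • a‖ ≤ 1 := by
    rw [norm_smul, norm_inv, Real.norm_of_nonneg hα.le, ← div_eq_inv_mul, div_le_one hα]
    exact ha
  have hy : ‖s⁻¹ • h‖ ≤ 1 := by
    rw [norm_smul, norm_inv, Real.norm_of_nonneg hs.le, ← div_eq_inv_mul, div_le_one hs]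
    exact hh
  choose c hc0 hc using fun m => (hP m).exists_coeff (α⁻¹ • a) (s⁻¹ • h)
  let d : ℕ → ℕ → Y := fun m k => (α ^ (m - k) * s ^ k) • c m k
  have hd0 : ∀ m k, m < k → d m k = 0 := fun m k hk => by simp [d, hc0 m k hk]
  have hdb : ∀ m k, ‖d m k‖ ≤ (s / s') ^ k * ((m + 1) * C * Q ^ m) := by
    intro m k
    rcases lt_or_ge m k with hk | hk
    · rw [hd0 m k hk, norm_zero]; positivity
    have h3 := norm_coeff_mul_pow_le hC hr0 (hb m) (hc0 m) (hc m)
      (norm_cos_smul_add_sin_smul_le_sqrt_two hx hy) (τ := s' / α) (by positivity) k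
    have e1 : √2 / r * (1 + s' / α) = Q / α := by rw [hQdef]; field_simp
    rw [e1, div_pow, div_pow] at h3
    have e2 : α ^ m = α ^ (m - k) * α ^ k := by rw [← pow_add, Nat.sub_add_cancel hk]
    have h4 : α ^ (m - k) * ‖c m k‖ * s' ^ k ≤ (m + 1) * C * Q ^ m := by
      calc α ^ (m - k) * ‖c m k‖ * s' ^ k = (‖c m k‖ * (s' ^ k / α ^ k)) * α ^ m := by
            rw [e2]; field_simp
        _ ≤ ((m + 1) * C * (Q ^ m / α ^ m)) * α ^ m := by gcongr
        _ = _ := by field_simp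
    have h5 : ‖d m k‖ = (s / s') ^ k * (α ^ (m - k) * ‖c m k‖ * s' ^ k) := by
      simp only [d]
      rw [norm_smul, Real.norm_of_nonneg (by positivity), div_pow]
      field_simp
    rw [h5]
    gcongr
  have hsum : ∀ t : ℝ, |t| * (s / s') < 1 →
      HasSum (fun k => t ^ k • ∑' m, d m k) (powerSeriesSum P (a + t • h)) := by
    intro t ht
    convert hasSum_rearranged hd0 (by positivity) hw (fun m => by positivity) hdb ht using 1
    refine tsum_congr fun m => ?_
    have h3 := hc m α (t * s)
    rw [smul_smul, smul_smul, mul_inv_cancel₀ hα.ne', one_smul, mul_assoc, mul_inv_cancel₀ hs.ne',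
      mul_one] at h3
    rw [h3]
    refine Finset.sum_congr rfl fun k _ => ?_
    simp only [d]
    rw [smul_smul, mul_pow]
    congr 1
    ring
  have hev : ∀ᶠ t : ℝ in 𝓝 0, |t| * (s / s') < 1 := by
    have : Tendsto (fun t : ℝ => |t| * (s / s')) (𝓝 0) (𝓝 (|0| * (s / s'))) :=
      (by fun_prop : Continuous fun t : ℝ => |t| * (s / s')).tendsto 0
    exact this.eventually_lt_const (by simp)
  have hT : ∀ k, taylorTerm (powerSeriesSum P) a k h = ∑' m, d m k :=
    taylorTerm_eq_of_hasSum_line (smoothNear_powerSeriesSum hP haD) (hev.mono hsum)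
  refine ⟨fun k => ?_, ?_⟩
  · rw [hT]
    exact norm_tsum_coeff_le hw hdb k
  · simpa [hT] using hsum 1 (by simpa using hq1)

theorem analyticAt_line {P : ℕ → X → Y} (hP : ∀ m, IsContHomogPoly m (P m)) (a h : X) (t : ℝ)
    (ht : a + t • h ∈ convDomain P) :
    AnalyticAt ℝ (fun s : ℝ => powerSeriesSum P (a + s • h)) t := by
  obtain ⟨d, hd⟩ := exists_hasSum_line hP ht h
  have h1 : AnalyticAt ℝ (fun s : ℝ => powerSeriesSum P (a + t • h + s • h)) (t - t) := by
    rw [sub_self]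
    exact ⟨_, hasFPowerSeriesAt_scalarSeries hd⟩
  have h2 := h1.comp (g := fun s : ℝ => powerSeriesSum P (a + t • h + s • h))
    (f := fun s : ℝ => s - t) (analyticAt_id.sub analyticAt_const)
  refine h2.congr (Eventually.of_forall fun s => ?_)
  simp only [Function.comp_apply]
  rw [add_assoc, ← add_smul, add_sub_cancel]

/-- Identity principle: both the sum of the series and the sum of its Taylor series at `a` are
analytic along the segment from `a` to `x`, and they agree near `a`. -/
theorem hasSum_taylorTerm {P : ℕ → X → Y} (hP : ∀ m, IsContHomogPoly m (P m)) {a x : X}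
    (ha : a ∈ convDomain P) (hx : x ∈ convDomain P) {s : ℝ} (hs : 0 < s)
    (hloc : ∀ h : X, ‖h‖ ≤ s →
      HasSum (fun k => taylorTerm (powerSeriesSum P) a k h) (powerSeriesSum P (a + h)))
    (hxa : edist x a < unifConvRadius (taylorTerm (powerSeriesSum P) a)) :
    HasSum (fun k => taylorTerm (powerSeriesSum P) a k (x - a)) (powerSeriesSum P x) := by
  set T := taylorTerm (powerSeriesSum P) a with hTdef
  have hT : ∀ m, IsContHomogPoly m (T m) :=
    isContHomogPoly_taylorTerm _ _
  have hxT : x - a ∈ convDomain T := by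
    simpa [convDomain, edist_eq_enorm_sub] using hxa
  have e1 : ∀ t ∈ Set.Icc (0 : ℝ) 1, a + t • (x - a) ∈ convDomain P := by
    intro t ht
    obtain ⟨r₁, -, h1, h1'⟩ := exists_norm_lt_ofReal_lt ha
    obtain ⟨r₂, -, h2, h2'⟩ := exists_norm_lt_ofReal_lt hx
    have hc := (convex_ball (0 : X) (max r₁ r₂)).add_smul_sub_mem
      (mem_ball_zero_iff.2 (h1.trans_le (le_max_left _ _)))
      (mem_ball_zero_iff.2 (h2.trans_le (le_max_right _ _))) ht
    refine edist_zero_lt_of_norm_lt (mem_ball_zero_iff.1 hc) ?_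
    rcases max_choice r₁ r₂ with h | h <;> rw [h]
    exacts [h1'.le, h2'.le]
  have e2 : ∀ t ∈ Set.Icc (0 : ℝ) 1, 0 + t • (x - a) ∈ convDomain T := by
    intro t ht
    obtain ⟨r, -, h1, h1'⟩ := exists_norm_lt_ofReal_lt hxT
    refine edist_zero_lt_of_norm_lt (lt_of_le_of_lt ?_ h1) h1'.le
    rw [zero_add, norm_smul, Real.norm_of_nonneg ht.1]
    exact mul_le_of_le_one_left (norm_nonneg _) ht.2
  have hA : AnalyticOnNhd ℝ (fun t : ℝ => powerSeriesSum P (a + t • (x - a))) (Set.Icc 0 1) :=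
    fun t ht => analyticAt_line hP a (x - a) t (e1 t ht)
  have hB : AnalyticOnNhd ℝ (fun t : ℝ => powerSeriesSum T (0 + t • (x - a))) (Set.Icc 0 1) :=
    fun t ht => analyticAt_line hT 0 (x - a) t (e2 t ht)
  have hev : (fun t : ℝ => powerSeriesSum P (a + t • (x - a))) =ᶠ[𝓝 0]
      fun t : ℝ => powerSeriesSum T (0 + t • (x - a)) := by
    have h1 : Tendsto (fun t : ℝ => ‖t • (x - a)‖) (𝓝 0) (𝓝 ‖(0 : ℝ) • (x - a)‖) :=
      (by fun_prop : Continuous fun t : ℝ => ‖t • (x - a)‖).tendsto 0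
    filter_upwards [h1.eventually_lt_const (by simpa using hs)] with t ht
    rw [zero_add]
    exact (hloc _ ht.le).tsum_eq.symm
  have h := hA.eqOn_of_preconnected_of_eventuallyEq hB isPreconnected_Icc
    (Set.left_mem_Icc.2 zero_le_one) hev (Set.right_mem_Icc.2 zero_le_one)
  simp only [one_smul, zero_add, add_sub_cancel] at h
  rw [h]
  exact (summable_norm_of_mem_convDomain hT hxT).of_norm.hasSum

/-- A power series is fully analytic in the ball of radius `ρ / √2`. The domain may be a smaller
ball than the ball of convergence, since differentiation is only known not to decrease the radius.
-/ theorem isFullyAnalyticIn_of_eqOn {P : ℕ → X → Y} (hP : ∀ m, IsContHomogPoly m (P m))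
    {R : ENNReal} (hR : R ≤ unifConvRadius P) {G : X → Y}
    (hG : ∀ x : X, edist x 0 < R → G x = powerSeriesSum P x) :
    IsFullyAnalyticIn G {x | edist x 0 < R} {x | edist x 0 < R / ENNReal.ofReal √2} := by
  have h2 : (1 : ℝ) ≤ √2 := Real.one_le_sqrt.2 (by norm_num)
  have h2' : (1 : ENNReal) ≤ ENNReal.ofReal √2 := by simp
  have hle : R / ENNReal.ofReal √2 ≤ R := ENNReal.div_le_of_le_mul (le_mul_of_one_le_right' h2')
  refine ⟨fun x hx => lt_of_lt_of_le hx hle, fun a ha => ?_⟩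
  have haR : edist a 0 < R := lt_of_lt_of_le ha hle
  have haP : a ∈ convDomain P := lt_of_lt_of_le haR hR
  have hopen : IsOpen {x : X | edist x 0 < R} := isOpen_lt (by fun_prop) continuous_const
  have hGF : G =ᶠ[𝓝 a] powerSeriesSum P := by
    filter_upwards [hopen.mem_nhds haR] with x hx using hG x hx
  have hbound : ∀ s : ℝ, 0 < s → ENNReal.ofReal (‖a‖ + s) < R / ENNReal.ofReal √2 →
      ∃ q W : ℝ, 0 ≤ q ∧ q < 1 ∧ ∀ h : X, ‖h‖ ≤ s →
        (∀ k, ‖taylorTerm (powerSeriesSum P) a k h‖ ≤ q ^ k * W) ∧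
        HasSum (fun k => taylorTerm (powerSeriesSum P) a k h) (powerSeriesSum P (a + h)) := by
    intro s hs hsR
    obtain ⟨β, h1, h3⟩ := ENNReal.lt_iff_exists_nnreal_btwn.1 hsR
    have h1' : ‖a‖ + s < β := (ENNReal.ofReal_lt_coe_iff (by positivity)).1 h1
    have h4 : ENNReal.ofReal (√2 * β) < R := by
      rw [ENNReal.lt_div_iff_mul_lt (by simp) (by simp)] at h3
      rw [ENNReal.ofReal_mul (by positivity), mul_comm]
      simpa using h3
    obtain ⟨α, hα1, hα2⟩ := exists_between (lt_sub_iff_add_lt.2 h1')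
    have hα : 0 < α := (norm_nonneg a).trans_lt hα1
    refine exists_taylorTerm_bound hP hα hα1.le hs ?_ (h4.trans_le hR)
    have : α + s < β := by linarith
    gcongr
  have hT : taylorTerm G a = taylorTerm (powerSeriesSum P) a := taylorTerm_congr hGF
  have hconv : ∀ s : ℝ, 0 < s → ENNReal.ofReal (‖a‖ + s) < R / ENNReal.ofReal √2 →
      SeriesConvergesUniformlyOn (taylorTerm G a) (Metric.closedBall 0 s) := by
    intro s hs hsR
    obtain ⟨q, W, hq0, hq1, hb⟩ := hbound s hs hsR
    rw [hT]
    exact seriesConvergesUniformlyOn_of_norm_le ((summable_geometric_of_lt_one hq0 hq1).mul_right W)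
      fun k h hh => (hb h (by simpa using hh)).1 k
  obtain ⟨s, hs, hsR⟩ : ∃ s : ℝ, 0 < s ∧ ENNReal.ofReal (‖a‖ + s) < R / ENNReal.ofReal √2 := by
    obtain ⟨r, -, h1, h3⟩ := exists_norm_lt_ofReal_lt (R := R / ENNReal.ofReal √2) ha
    exact ⟨r - ‖a‖, by linarith, by simpa using h3⟩
  refine ⟨⟨?_, ?_, fun x hx hxa => ?_⟩, fun r hr hsub => ?_⟩
  · exact ⟨_, hopen, haR, ((contDiffOn_powerSeriesSum hP).mono
      fun x hx => lt_of_lt_of_le hx hR).congr hG⟩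
  · have h1 := le_unifConvRadius (r := ⟨s, hs.le⟩) (hconv s hs hsR)
    exact lt_of_lt_of_le (ENNReal.coe_pos.2 hs) h1
  · obtain ⟨q, W, hq0, hq1, hb⟩ := hbound s hs hsR
    rw [hT] at hxa ⊢
    rw [hG x hx]
    exact hasSum_taylorTerm hP haP (lt_of_lt_of_le hx hR) hs (fun h hh => (hb h hh).2) hxa
  · obtain ⟨s', hs', h1, h3⟩ := exists_norm_add_lt_of_closedBall_subset hr ha hsub
    obtain ⟨G', hG'⟩ := hconv s' hs' h1
    exact ⟨G', hG'.mono h3⟩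

end FullyAnalytic

/-! ### The radius of analyticity -/

theorem theorem4p2 {X Y : Type*} [NormedAddCommGroup X] [NormedSpace ℝ X] [CompleteSpace X]
    [NormedAddCommGroup Y] [NormedSpace ℝ Y] [CompleteSpace Y]
    (P : ℕ → X → Y) (hP : ∀ m, IsContHomogPoly m (P m))
    (hρ : 0 < unifConvRadius P) :
    -- (i)
    unifConvRadius P / ENNReal.ofReal (Real.sqrt 2)
        ≤ analyticityRadius (powerSeriesSum P) (convDomain P) 0 ∧
    -- (ii); the first clause says that all the Fréchet derivatives exist where the series
    -- defines a function
    (ContDiffOn ℝ ∞ (powerSeriesSum P) (convDomain P) ∧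
      ∀ n : ℕ,
        (n ≤ 2 → unifConvRadius P / ENNReal.ofReal (Real.sqrt 2)
          ≤ unifConvRadius (taylorTerm (iteratedFDeriv ℝ n (powerSeriesSum P)) 0)) ∧
        (3 ≤ n → unifConvRadius P / ENNReal.ofReal (Real.sqrt (Real.exp 1))
          ≤ unifConvRadius (taylorTerm (iteratedFDeriv ℝ n (powerSeriesSum P)) 0))) ∧
    -- (iii)
    (∀ n : ℕ, unifConvRadius P / ENNReal.ofReal (Real.sqrt 2)
      ≤ analyticityRadius (iteratedFDeriv ℝ n (powerSeriesSum P)) (convDomain P) 0) := by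
  have hfull : ∀ n : ℕ, IsFullyAnalyticIn (iteratedFDeriv ℝ n (powerSeriesSum P)) (convDomain P)
      {x | edist x 0 < unifConvRadius P / ENNReal.ofReal √2} := by
    intro n
    obtain ⟨Q, hQ, hR, hF⟩ := exists_iteratedFDeriv_eq_powerSeriesSum hP n
    exact isFullyAnalyticIn_of_eqOn hQ hR hF
  have hpos : 0 < unifConvRadius P / ENNReal.ofReal √2 :=
    ENNReal.div_pos hρ.ne' ENNReal.ofReal_ne_top
  have hT : ∀ n : ℕ, unifConvRadius P / ENNReal.ofReal √2
      ≤ unifConvRadius (taylorTerm (iteratedFDeriv ℝ n (powerSeriesSum P)) 0) :=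
    fun n => (hfull n).le_unifConvRadius_taylorTerm hpos
  have he : ENNReal.ofReal √2 ≤ ENNReal.ofReal √(Real.exp 1) := by
    refine ENNReal.ofReal_le_ofReal (Real.sqrt_le_sqrt ?_)
    have := Real.add_one_le_exp 1
    linarith
  exact ⟨le_sSup (isFullyAnalyticIn_of_eqOn hP le_rfl fun _ _ => rfl),
    ⟨contDiffOn_powerSeriesSum hP, fun n => ⟨fun _ => hT n,
      fun _ => (ENNReal.div_le_div_left he _).trans (hT n)⟩⟩,
    fun n => le_sSup (hfull n)⟩
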